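/- Let $\tau = 1.8637065\ldots$ be the largest real root of the cubic equation $x^3 - x^2 - 3 = 0$. For every finite planar multigraph $G$ (loops and parallel edges are allowed) with $n$ edges, the number $t(G)$ of spanning trees of $G$ satisfies $t(G) \le \tau^n$. -/

import Mathlib

/-- The multigraph `G` is connected: it has a vertex, and any two vertices are joined by a
walk. -/
def Graph.IsConnected {α β : Type*} (G : Graph α β) : Prop :=
  G.vertexSet.Nonempty ∧
    ∀ x ∈ G.vertexSet, ∀ y ∈ G.vertexSet, Relation.ReflTransGen G.Adj x y

/-- The vertices `v 0, …, v k` and the edges `e 0, …, e k` form a cycle of length `k + 1` in `G`: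
the vertices are distinct, the edges are distinct, and `e i` joins `v i` to the cyclically next
vertex (the addition in `Fin (k + 1)` is modulo `k + 1`). A loop is a cycle of length one, and two
parallel edges form a cycle of length two. -/
def Graph.IsCycle {α β : Type*} (G : Graph α β) {k : ℕ}
    (v : Fin (k + 1) → α) (e : Fin (k + 1) → β) : Prop :=
  Function.Injective v ∧ Function.Injective e ∧ ∀ i, G.IsLink (e i) (v i) (v (i + 1))

/-- The multigraph `G` has no cycles. -/
def Graph.HasNoCycle {α β : Type*} (G : Graph α β) : Prop :=
  ∀ (k : ℕ) (v : Fin (k + 1) → α) (e : Fin (k + 1) → β), ¬ G.IsCycle v e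

/-- A tree is a connected multigraph without cycles. -/
def Graph.IsTree {α β : Type*} (G : Graph α β) : Prop :=
  G.IsConnected ∧ G.HasNoCycle

/-- The spanning trees of `G`: the subgraphs of `G` that contain all vertices of `G` and are
trees. -/
def Graph.spanningTrees {α β : Type*} (G : Graph α β) : Set (Graph α β) :=
  {T | T.IsSpanningSubgraph G ∧ T.IsTree}

/-- A multigraph with finitely many edges has finitely many spanning trees, so that the number of
them is `G.spanningTrees.ncard`. -/
theorem Graph.finite_spanningTrees {α β : Type*} (G : Graph α β) (hE : G.edgeSet.Finite) :
    G.spanningTrees.Finite := by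
  refine Set.Finite.of_finite_image (f := fun T : Graph α β => T.edgeSet)
    (hE.finite_subsets.subset ?_) ?_
  · rintro _ ⟨T, hT, rfl⟩
    exact hT.1.le.edgeSet_mono
  · intro S hS T hT h
    have hST : S.edgeSet = T.edgeSet := h
    refine Graph.ext (hS.1.vertexSet_eq.trans hT.1.vertexSet_eq.symm) fun e x y => ?_
    constructor
    · intro he
      exact (hT.1.le.isLink_iff (hST ▸ he.edge_mem)).2 (he.mono hS.1.le)
    · intro he
      exact (hS.1.le.isLink_iff (hST ▸ he.edge_mem)).2 (he.mono hT.1.le)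

/-- A drawing of the multigraph `G` in the Euclidean plane without crossings. The vertices are
distinct points, and every edge is a continuous curve that runs from one end of the edge to the
other, does not meet itself (except that a loop returns to its starting point), passes through no
vertex in between, and meets no other edge except at common ends. The values of `point` and
`curve` outside the vertex set and the edge set are irrelevant. -/
structure Graph.PlaneDrawing {α β : Type*} (G : Graph α β) where
  /-- The position of a vertex. -/
  point : α → EuclideanSpace ℝ (Fin 2)
  /-- The curve that represents an edge. -/
  curve : β → C(unitInterval, EuclideanSpace ℝ (Fin 2))
  point_injOn : Set.InjOn point G.vertexSet
  curve_ends : ∀ e ∈ G.edgeSet,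
    ∃ x y, G.IsLink e x y ∧ curve e 0 = point x ∧ curve e 1 = point y
  curve_injOn : ∀ e ∈ G.edgeSet, Set.InjOn (curve e) (Set.Ioo 0 1)
  curve_ne_point : ∀ e ∈ G.edgeSet, ∀ t ∈ Set.Ioo (0 : unitInterval) 1,
    ∀ x ∈ G.vertexSet, curve e t ≠ point x
  curve_disjoint : ∀ e ∈ G.edgeSet, ∀ f ∈ G.edgeSet, e ≠ f →
    Disjoint (curve e '' Set.Ioo 0 1) (curve f '' Set.Ioo 0 1)

/-- A multigraph is planar if it can be drawn in the plane without crossings. -/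
def Graph.IsPlanar {α β : Type*} (G : Graph α β) : Prop :=
  Nonempty G.PlaneDrawing

/-! Every minor with at least one edge of a planar multigraph has a nonempty cut, or a nonempty
support of a flow, with at most three edges. Suppose not, and let the minor have m edges. If all
cuts have at least four edges, so do the nontrivial vertex stars; as an edge lies in at most two
stars, the cut space has dimension less than m/2 (`two_mul_finrank_range_coboundary_lt`). By planar
duality the flows are the cuts of the dual, so the flow space has dimension less than m/2 too. But
the two dimensions add up to m (`exists_small_cut_or_flow`).

A spanning tree meets every cut and contains no support of a nonzero flow. Branching on the first
edge of the small set that is in the tree (for a cut) or outside it (for a flow) bounds the count by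
τ^(m-1) + τ^(m-2) + τ^(m-3), by induction on m (`Finset.card_le_pow_of_small_sets`). So any τ ≥ 1
with τ^2 + τ + 1 ≤ τ^3 will do, and the root of the cubic satisfies this because τ ≤ 2.

Duality is needed only for the square grid, where it is an explicit summation
(`exists_eq_coboundary_of_grid_flow`). A plane drawing, viewed on a fine enough grid, makes the
non-loops a grid minor (`Graph.PlaneDrawing.nonempty_gridMinor`), and cuts and flows pass between
the grid and the multigraph. -/

theorem exists_isGreatest_cubic_root :
    ∃ τ : ℝ, IsGreatest {x : ℝ | x ^ 3 - x ^ 2 - 3 = 0} τ ∧ 1.8637065 ≤ τ ∧ τ < 1.8637066 := by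
  have hc : ContinuousOn (fun x : ℝ => x ^ 3 - x ^ 2 - 3) (Set.Icc 1.8637065 1.8637066) := by
    fun_prop
  obtain ⟨τ, hτ, h0⟩ := intermediate_value_Ico (by norm_num) hc
    (show (0 : ℝ) ∈ Set.Ico _ _ by constructor <;> norm_num)
  refine ⟨τ, ⟨h0, fun x hx => ?_⟩, hτ.1, hτ.2⟩
  by_contra! hlt
  have h1 := hτ.1
  have hx' : x ^ 3 - x ^ 2 - 3 = 0 := hx
  have h0' : τ ^ 3 - τ ^ 2 - 3 = 0 := h0
  -- The second factor is grouped so that each term is positive once x and τ exceed 1.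
  have hprod : (x - τ) * (x * (x - 1) + τ * (τ - 1) + x * τ) = 0 := by linear_combination hx' - h0'
  have : 0 < (x - τ) * (x * (x - 1) + τ * (τ - 1) + x * τ) := by
    have : 0 < x - 1 := by linarith
    have : 0 < τ - 1 := by linarith
    have : 0 < x := by linarith
    have : 0 < τ := by linarith
    have : 0 < x - τ := by linarith
    positivity
  linarith

/-! ### Counting by deletion and contraction -/

section Counting

variable {β : Type*} [DecidableEq β]

/-- The members of `𝒯` that contain `C` and avoid `D`. -/
def Finset.between (𝒯 : Finset (Finset β)) (C D : Finset β) : Finset (Finset β) :=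
  𝒯.filter fun T => C ⊆ T ∧ Disjoint T D

theorem Finset.card_between_le_add (𝒯 : Finset (Finset β)) (C D : Finset β) (a : β) :
    (𝒯.between C D).card ≤ (𝒯.between (insert a C) D).card + (𝒯.between C (insert a D)).card := by
  refine (Finset.card_le_card (t := 𝒯.between (insert a C) D ∪ 𝒯.between C (insert a D))
    fun T hT => ?_).trans (Finset.card_union_le _ _)
  simp only [Finset.between, Finset.mem_union, Finset.mem_filter, Finset.insert_subset_iff,
    Finset.disjoint_insert_right] at hT ⊢
  tauto

/-- Branch on the first element of `A` that is put into `C`; by `h0` the branch that puts all of `A`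
into `D` is empty. The count is an abstract `f` so that containing and avoiding can exchange roles.
-/
theorem Finset.card_between_le_of_meet {τ : ℝ} (hτ : 1 ≤ τ) (hτ3 : τ ^ 2 + τ + 1 ≤ τ ^ 3)
    (f : Finset β → Finset β → ℕ)
    (hadd : ∀ C D a, f C D ≤ f (insert a C) D + f C (insert a D))
    {E C D A : Finset β} (hA : A ⊆ E \ (C ∪ D)) (hA0 : A.Nonempty) (hA3 : A.card ≤ 3)
    (h0 : f C (A ∪ D) = 0)
    (ih : ∀ C' D', C ⊆ C' → D ⊆ D' → C' ⊆ C ∪ A → D' ⊆ D ∪ A → Disjoint C' D' →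
      (E \ (C' ∪ D')).card < (E \ (C ∪ D)).card → (f C' D' : ℝ) ≤ τ ^ (E \ (C' ∪ D')).card)
    (hCD : Disjoint C D) :
    (f C D : ℝ) ≤ τ ^ (E \ (C ∪ D)).card := by
  have step : ∀ (S X Y : Finset β), S ⊆ E \ (C ∪ D) → X ∪ Y = C ∪ D ∪ S →
      (E \ (X ∪ Y)).card + S.card = (E \ (C ∪ D)).card := by
    intro S X Y hS h
    rw [h, ← Finset.card_sdiff_add_card_eq_card hS, sdiff_sdiff_left]
    rfl
  -- A branch that decides the elements of `S` leaves `S.card` fewer free elements; multiplying by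
  -- that power of τ gives all branches the same bound.
  have key : ∀ (S X Y : Finset β), S.Nonempty → S ⊆ A → X ∪ Y = C ∪ D ∪ S → Disjoint X Y →
      C ⊆ X → D ⊆ Y → X ⊆ C ∪ A → Y ⊆ D ∪ A →
      (f X Y : ℝ) * τ ^ S.card ≤ τ ^ (E \ (C ∪ D)).card := by
    intro S X Y hS0 hSA h hd h1 h2 h3 h4
    have h5 := step S X Y (hSA.trans hA) h
    have := hS0.card_pos
    rw [← h5, pow_add]
    gcongr
    exact ih X Y h1 h2 h3 h4 hd (by omega)
  have hpos : (0 : ℝ) < τ := by linarith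
  set M := τ ^ (E \ (C ∪ D)).card with hM
  have hM0 : 0 < M := by positivity
  have hmem : ∀ a ∈ A, a ∉ C ∧ a ∉ D := fun a ha => by
    have := hA ha; simp at this; tauto
  have hc : A.card = 1 ∨ A.card = 2 ∨ A.card = 3 := by have := hA0.card_pos; omega
  rcases hc with hc | hc | hc
  · obtain ⟨a, rfl⟩ := Finset.card_eq_one.1 hc
    have ha := hmem a (by simp)
    have e1 := hadd C D a
    have k1 := key {a} (insert a C) D (by simp) (by simp) (by clear * -; grind)
      (by simp [ha, hCD]) (by simp) (by simp) (by clear * -; grind) (by clear * -; grind)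
    have : insert a D = {a} ∪ D := by ext; simp
    rw [this, h0] at e1
    simp only [Finset.card_singleton, pow_one] at k1
    have e1' : (f C D : ℝ) ≤ f (insert a C) D := by exact_mod_cast e1
    have := mul_le_mul_of_nonneg_left hτ (Nat.cast_nonneg (α := ℝ) (f (insert a C) D))
    linarith
  · obtain ⟨a, b, hab, rfl⟩ := Finset.card_eq_two.1 hc
    have ha := hmem a (by simp)
    have hb := hmem b (by simp)
    have e1 := hadd C D a
    have e2 := hadd C (insert a D) b
    have k1 := key {a} (insert a C) D (by simp) (by simp) (by clear * -; grind)
      (by simp [ha, hCD]) (by simp) (by simp) (by clear * -; grind) (by clear * -; grind)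
    have k2 := key {a, b} (insert b C) (insert a D) (by simp) (by simp) (by clear * -; grind)
      (by simp [ha, hb, hCD, hab]) (by simp) (by simp) (by clear * -; grind)
      (by clear * -; grind)
    have : insert b (insert a D) = {a, b} ∪ D := by ext; simp; tauto
    rw [this, h0] at e2
    rw [Finset.card_pair hab] at k2
    simp only [Finset.card_singleton, pow_one] at k1
    have e3 : (f C D : ℝ) ≤ f (insert a C) D + f (insert b C) (insert a D) := by
      exact_mod_cast (by omega : f C D ≤ f (insert a C) D + f (insert b C) (insert a D))
    have hsum : (f C D : ℝ) * τ ^ 2 ≤ M * τ + M := by nlinarith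
    -- One more factor τ reduces two branches to τ^2 + τ ≤ τ^3.
    have : (f C D : ℝ) * τ ^ 3 ≤ M * τ ^ 3 := by nlinarith
    exact le_of_mul_le_mul_right this (by positivity)
  · obtain ⟨a, b, c, hab, hac, hbc, rfl⟩ := Finset.card_eq_three.1 hc
    have ha := hmem a (by simp)
    have hb := hmem b (by simp)
    have hcc := hmem c (by simp)
    have e1 := hadd C D a
    have e2 := hadd C (insert a D) b
    have e3 := hadd C (insert b (insert a D)) c
    have k1 := key {a} (insert a C) D (by simp) (by simp) (by clear * -; grind)
      (by simp [ha, hCD]) (by simp) (by simp) (by clear * -; grind) (by clear * -; grind)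
    have k2 := key {a, b} (insert b C) (insert a D) (by simp) (by clear * -; grind)
      (by clear * -; grind)
      (by simp [ha, hb, hCD, hab]) (by simp) (by simp) (by clear * -; grind)
      (by clear * -; grind)
    have k3 := key {a, b, c} (insert c C) (insert b (insert a D)) (by simp) (by simp)
      (by clear * -; grind)
      (by simp [ha, hb, hcc, hCD, hac, hbc]) (by simp)
      (by clear * -; grind) (by clear * -; grind) (by clear * -; grind)
    have : insert c (insert b (insert a D)) = {a, b, c} ∪ D := by ext; simp; tauto
    rw [this, h0] at e3
    rw [hc] at k3
    rw [Finset.card_pair hab] at k2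
    simp only [Finset.card_singleton, pow_one] at k1
    have e4 : (f C D : ℝ) ≤ f (insert a C) D + f (insert b C) (insert a D)
        + f (insert c C) (insert b (insert a D)) := by
      exact_mod_cast (by omega : f C D ≤ f (insert a C) D + f (insert b C) (insert a D)
        + f (insert c C) (insert b (insert a D)))
    have : (f C D : ℝ) * τ ^ 3 ≤ M * τ ^ 3 := by
      calc (f C D : ℝ) * τ ^ 3 ≤ (f (insert a C) D + f (insert b C) (insert a D)
            + f (insert c C) (insert b (insert a D))) * τ ^ 3 := by gcongr
        _ = (f (insert a C) D * τ) * τ ^ 2 + (f (insert b C) (insert a D) * τ ^ 2) * τ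
            + f (insert c C) (insert b (insert a D)) * τ ^ 3 := by ring
        _ ≤ M * τ ^ 2 + M * τ + M := by gcongr
        _ = M * (τ ^ 2 + τ + 1) := by ring
        _ ≤ M * τ ^ 3 := by gcongr
    exact le_of_mul_le_mul_right this (by positivity)

/-- Deletion and contraction: a family of subsets of `E` has at most `τ ^ |E|` members if each of
its minors on a nonempty ground set has a transversal or a non-covered set of size at most three. -/
theorem Finset.card_le_pow_of_small_sets {τ : ℝ} (hτ : 1 ≤ τ) (hτ3 : τ ^ 2 + τ + 1 ≤ τ ^ 3)
    (E : Finset β) (𝒯 : Finset (Finset β)) (h𝒯 : ∀ T ∈ 𝒯, T ⊆ E)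
    (H : ∀ C D : Finset β, C ⊆ E → D ⊆ E → Disjoint C D → (E \ (C ∪ D)).Nonempty →
      ∃ A ⊆ E \ (C ∪ D), A.Nonempty ∧ A.card ≤ 3 ∧
        ((∀ T ∈ 𝒯, C ⊆ T → Disjoint T D → ¬ Disjoint T A) ∨
          (∀ T ∈ 𝒯, C ⊆ T → Disjoint T D → ¬ A ⊆ T))) :
    (𝒯.card : ℝ) ≤ τ ^ E.card := by
  suffices h : ∀ (k : ℕ) (C D : Finset β), (E \ (C ∪ D)).card = k → C ⊆ E → D ⊆ E →
      Disjoint C D → ((𝒯.between C D).card : ℝ) ≤ τ ^ (E \ (C ∪ D)).card by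
    simpa [Finset.between] using h _ ∅ ∅ rfl (by simp) (by simp) (by simp)
  intro k
  induction k using Nat.strong_induction_on with
  | _ k ih =>
  intro C D hk hC hD hCD
  rcases (E \ (C ∪ D)).eq_empty_or_nonempty with he | hne
  · rw [he, Finset.card_empty, pow_zero]
    have : (𝒯.between C D) ⊆ {C} := by
      intro T hT
      simp only [Finset.between, Finset.mem_filter] at hT
      obtain ⟨hT, hCT, hTD⟩ := hT
      rw [Finset.mem_singleton]
      refine Finset.Subset.antisymm (fun x hx => ?_) hCT
      have h1 := (Finset.sdiff_eq_empty_iff_subset.1 he) (h𝒯 T hT hx)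
      have h2 := Finset.disjoint_left.1 hTD hx
      simp at h1; tauto
    exact_mod_cast Finset.card_le_card this
  · obtain ⟨A, hA, hA0, hA3, h | h⟩ := H C D hC hD hCD hne
    · refine Finset.card_between_le_of_meet hτ hτ3 (fun C D => (𝒯.between C D).card)
        (fun C D a => 𝒯.card_between_le_add C D a) hA hA0 hA3 ?_ ?_ hCD
      · rw [Finset.card_eq_zero, Finset.between, Finset.filter_eq_empty_iff]
        rintro T hT ⟨h1, h2⟩
        rw [Finset.disjoint_union_right] at h2
        exact h T hT h1 h2.2 h2.1
      · intro C' D' _ _ h3 h4 h5 h6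
        have hAE : A ⊆ E := hA.trans Finset.sdiff_subset
        exact ih _ (hk ▸ h6) C' D' rfl (h3.trans (Finset.union_subset hC hAE))
          (h4.trans (Finset.union_subset hD hAE)) h5
    -- For a set that no member covers, the same recursion runs with `C` and `D` exchanged: the
    -- branch containing all of `A` is empty.
    · have := Finset.card_between_le_of_meet hτ hτ3 (fun D C => (𝒯.between C D).card)
        (fun D C a => by rw [add_comm]; exact 𝒯.card_between_le_add C D a)
        (E := E) (C := D) (D := C) (A := A) (by rwa [Finset.union_comm]) hA0 hA3 ?_ ?_ hCD.symm
      · rwa [Finset.union_comm]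
      · rw [Finset.card_eq_zero, Finset.between, Finset.filter_eq_empty_iff]
        rintro T hT ⟨h1, h2⟩
        exact h T hT (Finset.subset_union_right.trans h1) h2 (Finset.subset_union_left.trans h1)
      · intro D' C' _ _ h3 h4 h5 h6
        have hAE : A ⊆ E := hA.trans Finset.sdiff_subset
        rw [Finset.union_comm D' C'] at h6 ⊢
        rw [Finset.union_comm D C] at h6
        exact ih _ (hk ▸ h6) C' D' rfl (h4.trans (Finset.union_subset hC hAE))
          (h3.trans (Finset.union_subset hD hAE)) h5.symm

end Counting

/-! ### Cut spaces, flow spaces and their dimensions -/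

section Coboundary

variable {V F E : Type*}

/-- The coboundary of a function on the vertices of the directed multigraph with edges `E`, where
`e` runs from `s e` to `t e`. -/
def coboundary (s t : E → V) : (V → ℚ) →ₗ[ℚ] (E → ℚ) where
  toFun ψ e := ψ (t e) - ψ (s e)
  map_add' ψ φ := by ext e; simp only [Pi.add_apply]; ring
  map_smul' c ψ := by ext e; simp only [Pi.smul_apply, smul_eq_mul, RingHom.id_apply]; ring

@[simp] theorem coboundary_apply (s t : E → V) (ψ : V → ℚ) (e : E) :
    coboundary s t ψ e = ψ (t e) - ψ (s e) := rfl

/-- If all nonempty cuts have at least four edges, then the cut space has dimension less than half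
the number of edges. -/
theorem two_mul_finrank_range_coboundary_lt [Fintype E] [Nonempty E] (s t : E → V)
    (h : ∀ ψ, coboundary s t ψ ≠ 0 →
      4 ≤ (Finset.univ.filter fun e => coboundary s t ψ e ≠ 0).card) :
    2 * Module.finrank ℚ (LinearMap.range (coboundary s t)) < Fintype.card E := by
  classical
  -- `V` may be infinite, so potentials are expanded over the ends of edges only.
  set P : Finset V := Finset.univ.image s ∪ Finset.univ.image t with hP
  set g : V → E → ℚ := fun q => coboundary s t (Pi.single q 1) with hg
  have hsP : ∀ e, s e ∈ P := fun e => by simp [hP]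
  have htP : ∀ e, t e ∈ P := fun e => by simp [hP]
  have hexp : ∀ ψ, coboundary s t ψ = ∑ q ∈ P, ψ q • g q := by
    intro ψ
    ext e
    simp [hg, Pi.single_apply, mul_sub, Finset.sum_sub_distrib, hsP, htP]
  set Q := P.filter fun q => g q ≠ 0 with hQ
  have hexpQ : ∀ ψ, coboundary s t ψ = ∑ q ∈ Q, ψ q • g q := by
    intro ψ
    rw [hexp, hQ, Finset.sum_filter]
    refine Finset.sum_congr rfl fun q _ => ?_
    split_ifs with h0
    · rfl
    · rw [not_not.1 h0, smul_zero]
  -- Double counting of incidences between nontrivial stars and edges.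
  have hcount : 4 * Q.card ≤ 2 * Fintype.card E := by
    calc 4 * Q.card = ∑ q ∈ Q, 4 := by simp [mul_comm]
      _ ≤ ∑ q ∈ Q, (Finset.univ.filter fun e => g q e ≠ 0).card :=
          Finset.sum_le_sum fun q hq => h _ (Finset.mem_filter.1 hq).2
      _ = ∑ e, (Q.filter fun q => g q e ≠ 0).card := by
          simp only [Finset.card_filter]
          exact Finset.sum_comm
      _ ≤ ∑ e : E, 2 := by
          refine Finset.sum_le_sum fun e _ => ?_
          refine (Finset.card_le_card (t := {s e, t e}) fun q hq => ?_).trans Finset.card_le_two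
          have := (Finset.mem_filter.1 hq).2
          by_contra hne
          simp only [Finset.mem_insert, Finset.mem_singleton, not_or] at hne
          exact this (by simp [hg, Ne.symm hne.1, Ne.symm hne.2])
      _ = 2 * Fintype.card E := by simp [mul_comm]
  have hE := Fintype.card_pos (α := E)
  rcases Q.eq_empty_or_nonempty with h0 | ⟨q₀, hq₀⟩
  · have : LinearMap.range (coboundary s t) = ⊥ := by
      rw [eq_bot_iff]
      rintro _ ⟨ψ, rfl⟩
      rw [hexpQ, h0]; simp
    rw [this, finrank_bot]
    omega
  · have hle : LinearMap.range (coboundary s t) ≤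
        Submodule.span ℚ (((Q.erase q₀).image g : Finset (E → ℚ)) : Set (E → ℚ)) := by
      rintro _ ⟨ψ, rfl⟩
      -- Normalizing the potential to vanish at `q₀` saves one star, which makes the inequality
      -- strict.
      have h1 : coboundary s t ψ = coboundary s t (fun v => ψ v - ψ q₀) := by
        ext e; simp
      rw [h1, hexpQ, ← Finset.add_sum_erase _ _ hq₀, sub_self, zero_smul, zero_add]
      refine Submodule.sum_mem _ fun q hq => Submodule.smul_mem _ _ (Submodule.subset_span ?_)
      exact Finset.mem_coe.2 (Finset.mem_image_of_mem _ hq)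
    have h2 := (Submodule.finrank_mono hle).trans (finrank_span_finset_le_card _)
    have h3 := h2.trans Finset.card_image_le
    rw [Finset.card_erase_of_mem hq₀] at h3
    have := Finset.card_pos.2 ⟨q₀, hq₀⟩
    omega

/-- A flow on `R` after contracting `C` extends to a flow supported on `R ∪ C`. -/
theorem exists_flow_extension [DecidableEq E] (s t : E → V) {C R : Finset E} (hCR : Disjoint C R)
    (y : E → ℚ)
    (hy : ∀ ψ : V → ℚ, (∀ c ∈ C, coboundary s t ψ c = 0) →
      ∑ e ∈ R, y e * coboundary s t ψ e = 0) :
    ∃ u : E → ℚ, (∀ e ∈ R, u e = y e) ∧ (∀ e, e ∉ R → e ∉ C → u e = 0) ∧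
      ∀ ψ, ∑ e ∈ R ∪ C, u e * coboundary s t ψ e = 0 := by
  let Φ : (V → ℚ) →ₗ[ℚ] ℚ :=
    ∑ e ∈ R, y e • (LinearMap.proj e ∘ₗ coboundary s t)
  let L : C → (V → ℚ) →ₗ[ℚ] ℚ := fun c => LinearMap.proj (c : E) ∘ₗ coboundary s t
  have hΦ : ∀ ψ, Φ ψ = ∑ e ∈ R, y e * coboundary s t ψ e := fun ψ => by
    simp [Φ, LinearMap.sum_apply]
  -- `Φ` vanishes wherever all edge functionals of `C` do, so it is a combination of them; the
  -- negated coefficients are the flow values on `C`.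
  have hmem : Φ ∈ Submodule.span ℚ (Set.range L) := by
    refine mem_span_of_iInf_ker_le_ker fun ψ hψ => ?_
    rw [LinearMap.mem_ker, hΦ]
    refine hy ψ fun c hc => ?_
    have := (Submodule.mem_iInf _).1 hψ ⟨c, hc⟩
    simpa [L] using this
  obtain ⟨a, ha⟩ := (Submodule.mem_span_range_iff_exists_fun ℚ).1 hmem
  refine ⟨fun e => if e ∈ R then y e else if hc : e ∈ C then - a ⟨e, hc⟩ else 0,
    fun e he => by simp [he], fun e h1 h2 => by simp [h1, h2], fun ψ => ?_⟩
  rw [Finset.sum_union hCR.symm]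
  have h1 : ∑ e ∈ R, (if e ∈ R then y e else if hc : e ∈ C then - a ⟨e, hc⟩ else 0) *
      coboundary s t ψ e = Φ ψ := by
    rw [hΦ]
    exact Finset.sum_congr rfl fun e he => by simp [he]
  have h2 : ∑ e ∈ C, (if e ∈ R then y e else if hc : e ∈ C then - a ⟨e, hc⟩ else 0) *
      coboundary s t ψ e = - Φ ψ := by
    rw [← ha, ← Finset.sum_attach, LinearMap.sum_apply, ← Finset.sum_neg_distrib]
    refine Finset.sum_congr rfl fun c _ => ?_
    simp [L, Finset.disjoint_left.1 hCR c.2]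
  rw [h1, h2, add_neg_cancel]

/-- If the finitely supported flows of a multigraph are the finitely supported coboundaries of a
second multigraph with the same edges, then every nonempty finite minor has a cut or a flow with
at most three edges. -/
theorem exists_small_cut_or_flow [DecidableEq E] (s t : E → V) (s' t' : E → F)
    (hdual : ∀ (S : Finset E) (u : E → ℚ), (∀ e ∉ S, u e = 0) →
      (∀ ψ, ∑ e ∈ S, u e * coboundary s t ψ e = 0) → ∃ χ, u = coboundary s' t' χ)
    (hflow : ∀ (S : Finset E) (χ : F → ℚ), (∀ e ∉ S, coboundary s' t' χ e = 0) →
      ∀ ψ, ∑ e ∈ S, coboundary s' t' χ e * coboundary s t ψ e = 0)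
    {C R : Finset E} (hCR : Disjoint C R) (hR : R.Nonempty) :
    (∃ ψ : V → ℚ, (∀ c ∈ C, coboundary s t ψ c = 0) ∧
      (R.filter fun e => coboundary s t ψ e ≠ 0).Nonempty ∧
      (R.filter fun e => coboundary s t ψ e ≠ 0).card ≤ 3) ∨
    (∃ u : E → ℚ, (∀ e, e ∉ R → e ∉ C → u e = 0) ∧
      (∀ ψ, ∑ e ∈ R ∪ C, u e * coboundary s t ψ e = 0) ∧
      (R.filter fun e => u e ≠ 0).Nonempty ∧ (R.filter fun e => u e ≠ 0).card ≤ 3) := by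
  by_contra hcon
  push Not at hcon
  obtain ⟨hcut, hfl⟩ := hcon
  have : Nonempty R := hR.to_subtype
  have hfilter : ∀ w : E → ℚ, (Finset.univ.filter fun e : R => w e ≠ 0).card =
      (R.filter fun e => w e ≠ 0).card := by
    intro w
    refine Finset.card_bij (fun e _ => (e : E)) ?_ ?_ ?_
    · intro e he; simpa using he
    · intro e _ f _ h; exact Subtype.ext h
    · intro e he
      obtain ⟨h1, h2⟩ := Finset.mem_filter.1 he
      exact ⟨⟨e, h1⟩, by simpa using h2, rfl⟩
  have hne : ∀ w : E → ℚ, (fun e : R => w e) ≠ 0 → (R.filter fun e => w e ≠ 0).Nonempty := by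
    intro w hw
    obtain ⟨e, he⟩ := Function.ne_iff.1 hw
    exact ⟨e, Finset.mem_filter.2 ⟨e.2, he⟩⟩
  -- The minor contracts `C` and deletes all edges outside `R ∪ C`; in the dual these deleted edges
  -- are the contracted ones.
  let rC : V → V → Prop := fun x y => ∃ c ∈ C, s c = x ∧ t c = y
  let rD : F → F → Prop := fun x y => ∃ e, (e ∉ R ∧ e ∉ C) ∧ s' e = x ∧ t' e = y
  let δC := coboundary (fun e : R => Quot.mk rC (s e)) (fun e : R => Quot.mk rC (t e))
  let δD := coboundary (fun e : R => Quot.mk rD (s' e)) (fun e : R => Quot.mk rD (t' e))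
  have hA : 2 * Module.finrank ℚ (LinearMap.range δC) < Fintype.card R := by
    refine two_mul_finrank_range_coboundary_lt _ _ fun ψ hψ => ?_
    have h1 := hcut (fun v => ψ (Quot.mk rC v)) (fun c hc => by
      have : Quot.mk rC (s c) = Quot.mk rC (t c) := Quot.sound ⟨c, hc, rfl, rfl⟩
      simp [this]) (hne (coboundary s t fun v => ψ (Quot.mk rC v)) hψ)
    rw [← hfilter] at h1
    exact h1
  have hB : 2 * Module.finrank ℚ (LinearMap.range δD) < Fintype.card R := by
    refine two_mul_finrank_range_coboundary_lt _ _ fun χ hχ => ?_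
    have h0 : ∀ e, e ∉ R → e ∉ C → coboundary s' t' (fun v => χ (Quot.mk rD v)) e = 0 := by
      intro e h1 h2
      have : Quot.mk rD (s' e) = Quot.mk rD (t' e) := Quot.sound ⟨e, ⟨h1, h2⟩, rfl, rfl⟩
      simp [this]
    have h1 := hfl (coboundary s' t' fun v => χ (Quot.mk rD v)) h0
      (hflow _ _ fun e he => by
        rw [Finset.mem_union, not_or] at he
        exact h0 e he.1 he.2)
      (hne (coboundary s' t' fun v => χ (Quot.mk rD v)) hχ)
    rw [← hfilter] at h1
    exact h1
  let Λ : Module.Dual ℚ (R → ℚ) →ₗ[ℚ] (R → ℚ) :=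
    { toFun := fun f e => f (Pi.single e 1)
      map_add' := fun _ _ => rfl
      map_smul' := fun _ _ => rfl }
  have hΛ : ∀ (f : Module.Dual ℚ (R → ℚ)) (w : R → ℚ), f w = ∑ e, Λ f e * w e := by
    intro f w
    conv_lhs => rw [pi_eq_sum_univ' w]
    rw [map_sum]
    refine Finset.sum_congr rfl fun e _ => ?_
    rw [map_smul, smul_eq_mul, mul_comm]
    congr 2
  have hΛinj : Function.Injective Λ := by
    intro f g hfg
    refine LinearMap.ext fun w => ?_
    rw [hΛ, hΛ, hfg]
  -- A functional that kills the cuts of the minor is a flow on `R`. Extended over `C` it is a dual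
  -- coboundary, whose potential is constant along the deleted edges and so descends to `Quot rD`.
  have hle : (LinearMap.range δC).dualAnnihilator.map Λ ≤ LinearMap.range δD := by
    rintro _ ⟨f, hf, rfl⟩
    have hf' : ∀ w ∈ LinearMap.range δC, f w = 0 :=
      fun w hw => (Submodule.mem_dualAnnihilator f).1 hf w hw
    obtain ⟨u, hu1, hu2, hu3⟩ := exists_flow_extension s t hCR
      (fun e => if he : e ∈ R then Λ f ⟨e, he⟩ else 0) (by
        intro ψ hψ
        let φ : Quot rC → ℚ := Quot.lift ψ (by
          rintro _ _ ⟨c, hc, rfl, rfl⟩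
          have := hψ c hc
          simp only [coboundary_apply] at this
          linarith)
        have h1 := hf' _ ⟨φ, rfl⟩
        rw [hΛ] at h1
        rw [← Finset.sum_attach, ← h1]
        refine Finset.sum_congr rfl fun e _ => ?_
        simp [δC, φ])
    obtain ⟨χ, rfl⟩ := hdual (R ∪ C) u (fun e he => by
      rw [Finset.mem_union, not_or] at he
      exact hu2 e he.1 he.2) hu3
    refine ⟨Quot.lift χ ?_, ?_⟩
    · rintro _ _ ⟨e, ⟨h1, h2⟩, rfl, rfl⟩
      have := hu2 e h1 h2
      simp only [coboundary_apply] at this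
      linarith
    · ext e
      have := hu1 e e.2
      simp only [e.2, dif_pos] at this
      rw [← this]
      rfl
  -- The two ranks add up to at least the cardinality of `R`, although each is less than half of it.
  have h1 := Submodule.finrank_mono hle
  rw [← (Submodule.equivMapOfInjective Λ hΛinj _).finrank_eq] at h1
  have h2 := Subspace.finrank_add_finrank_dualAnnihilator_eq (LinearMap.range δC)
  rw [Module.finrank_fintype_fun_eq_card] at h2
  omega

end Coboundary

/-! ### Planar duality in the square grid -/

section Grid

/-- The tail of an edge of the square grid `ℤ × ℤ`. The edge `(i, j, false)` is horizontal and the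
edge `(i, j, true)` is vertical. -/
def gridTail (e : ℤ × ℤ × Bool) : ℤ × ℤ := (e.1, e.2.1)

/-- The head of an edge of the square grid. -/
def gridHead (e : ℤ × ℤ × Bool) : ℤ × ℤ := bif e.2.2 then (e.1, e.2.1 + 1) else (e.1 + 1, e.2.1)

/-- The face of the square grid to the right of an edge. -/
def gridRight (e : ℤ × ℤ × Bool) : ℤ × ℤ := bif e.2.2 then (e.1, e.2.1) else (e.1, e.2.1 - 1)

/-- The face of the square grid to the left of an edge. -/
def gridLeft (e : ℤ × ℤ × Bool) : ℤ × ℤ := bif e.2.2 then (e.1 - 1, e.2.1) else (e.1, e.2.1)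

theorem sum_mul_coboundary_grid_single (S : Finset (ℤ × ℤ × Bool)) (u : ℤ × ℤ × Bool → ℚ)
    (hu : ∀ e ∉ S, u e = 0) (i j : ℤ) :
    ∑ e ∈ S, u e * coboundary gridTail gridHead (Pi.single (i, j) 1) e =
      u (i - 1, j, false) + u (i, j - 1, true) - u (i, j, false) - u (i, j, true) := by
  set f := fun e => u e * coboundary gridTail gridHead (Pi.single (i, j) 1) e with hf
  -- The four edges at the vertex need not lie in `S`; a sum over all edges compares the two finite
  -- sums.
  have h1 : ∑ᶠ e, f e = ∑ e ∈ S, f e := by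
    refine finsum_eq_sum_of_support_subset _ fun e he => ?_
    by_contra h
    exact he (by simp [hf, hu e h])
  have h2 : ∑ᶠ e, f e = ∑ e ∈ {(i - 1, j, false), (i, j - 1, true), (i, j, false), (i, j, true)},
      f e := by
    refine finsum_eq_sum_of_support_subset _ fun e he => ?_
    by_contra h
    apply he
    obtain ⟨a, b, c⟩ := e
    have : (Pi.single (i, j) 1 : ℤ × ℤ → ℚ) (gridHead (a, b, c)) = 0 ∧
        (Pi.single (i, j) 1 : ℤ × ℤ → ℚ) (gridTail (a, b, c)) = 0 := by
      constructor <;> rw [Pi.single_apply, if_neg] <;> cases c <;>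
        simp [gridHead, gridTail] at h ⊢ <;> grind
    simp [hf, this]
  rw [← h1, h2, Finset.sum_insert (by simp), Finset.sum_insert (by simp),
    Finset.sum_insert (by simp), Finset.sum_singleton]
  simp [hf, gridHead, gridTail, Pi.single_apply]
  ring

/-- By linearity it suffices to test against the indicator of one vertex, where the differences of
`χ` around its four faces cancel. -/
theorem sum_coboundary_mul_coboundary_grid (S : Finset (ℤ × ℤ × Bool)) (χ : ℤ × ℤ → ℚ)
    (hχ : ∀ e ∉ S, coboundary gridRight gridLeft χ e = 0) (ψ : ℤ × ℤ → ℚ) :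
    ∑ e ∈ S, coboundary gridRight gridLeft χ e * coboundary gridTail gridHead ψ e = 0 := by
  classical
  set P : Finset (ℤ × ℤ) := S.image gridTail ∪ S.image gridHead with hP
  have hψ : ∀ e ∈ S, coboundary gridTail gridHead ψ e =
      ∑ v ∈ P, ψ v * coboundary gridTail gridHead (Pi.single v 1) e := by
    intro e he
    have h1 : gridTail e ∈ P := Finset.mem_union_left _ (Finset.mem_image_of_mem _ he)
    have h2 : gridHead e ∈ P := Finset.mem_union_right _ (Finset.mem_image_of_mem _ he)
    simp [mul_sub, Finset.sum_sub_distrib, Pi.single_apply, h1, h2]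
  rw [Finset.sum_congr rfl fun e he => by rw [hψ e he, Finset.mul_sum], Finset.sum_comm]
  refine Finset.sum_eq_zero fun v _ => ?_
  obtain ⟨i, j⟩ := v
  simp_rw [mul_left_comm _ (ψ (i, j)), ← Finset.mul_sum]
  rw [sum_mul_coboundary_grid_single S _ hχ]
  simp [gridRight, gridLeft]

/-- A discrete Poincaré lemma: the potential of a face is the total flow through the horizontal
edges below it in its column. Horizontal edges then come out right by definition, and vertical ones
by induction on the height, using conservation at each vertex. -/
theorem exists_eq_coboundary_of_grid_flow (S : Finset (ℤ × ℤ × Bool)) (u : ℤ × ℤ × Bool → ℚ)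
    (hu : ∀ e ∉ S, u e = 0)
    (hflow : ∀ ψ, ∑ e ∈ S, u e * coboundary gridTail gridHead ψ e = 0) :
    ∃ χ, u = coboundary gridRight gridLeft χ := by
  have hdiv : ∀ i j, u (i - 1, j, false) + u (i, j - 1, true) - u (i, j, false) - u (i, j, true)
      = 0 := fun i j => by
    rw [← sum_mul_coboundary_grid_single S u hu]; exact hflow _
  obtain ⟨m, hm⟩ : ∃ m : ℤ, ∀ i j b, j < m → u (i, j, b) = 0 := by
    obtain ⟨m, hm⟩ := (S.image fun e => e.2.1).bddBelow
    refine ⟨m, fun i j b hj => hu _ fun h => ?_⟩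
    have := hm (Finset.mem_coe.2 (Finset.mem_image_of_mem (fun e => e.2.1) h))
    simp at this
    omega
  let χ : ℤ × ℤ → ℚ := fun p => ∑ k ∈ Finset.Ico m (p.2 + 1), u (p.1, k, false)
  have hlow : ∀ i j, j < m → χ (i, j) = 0 := fun i j hj => by
    simp only [χ]
    rw [Finset.Ico_eq_empty (by simp; omega), Finset.sum_empty]
  have hstep : ∀ i j, χ (i, j) = χ (i, j - 1) + u (i, j, false) := by
    intro i j
    rcases lt_or_ge j m with hj | hj
    · rw [hlow _ _ hj, hlow _ _ (by omega), hm _ _ _ hj, add_zero]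
    · simp only [χ, sub_add_cancel]
      rw [← Finset.insert_Ico_right_eq_Ico_add_one hj, Finset.sum_insert (by simp), add_comm]
  have hvert : ∀ i j, m - 1 ≤ j → u (i, j, true) = χ (i - 1, j) - χ (i, j) := by
    intro i j hj
    induction j, hj using Int.leInduction with
    | base => rw [hlow _ _ (by omega), hlow _ _ (by omega), hm _ _ _ (by omega), sub_zero]
    | succ j hj ih =>
      have h1 := hdiv i (j + 1)
      have h2 := hstep i (j + 1)
      have h3 := hstep (i - 1) (j + 1)
      rw [add_sub_cancel_right] at h1 h2 h3
      linarith
  refine ⟨χ, funext ?_⟩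
  rintro ⟨i, j, b⟩
  cases b
  · have := hstep i j
    simp only [coboundary_apply, gridLeft, gridRight, cond_false]
    linarith
  · simp only [coboundary_apply, gridLeft, gridRight, cond_true]
    rcases lt_or_ge j m with hj | hj
    · rw [hlow _ _ hj, hlow _ _ hj, hm _ _ _ hj, sub_zero]
    · exact hvert i j (by omega)

end Grid

/-! ### Connected sets of grid points and discretization -/

section GridConnectivity

/-- A set of grid points is preconnected if every set that is not separated from its complement
along a grid edge inside it contains all of it or none of it. -/
def GridPreconnected (B : Set (ℤ × ℤ)) : Prop :=
  ∀ U : Set (ℤ × ℤ), (∀ g, gridTail g ∈ B → gridHead g ∈ B → (gridTail g ∈ U ↔ gridHead g ∈ U)) →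
    ∀ p ∈ B, ∀ q ∈ B, p ∈ U → q ∈ U

theorem GridPreconnected.eq_of_forall_edge {B : Set (ℤ × ℤ)} (hB : GridPreconnected B)
    {ψ : ℤ × ℤ → ℚ}
    (hψ : ∀ g, gridTail g ∈ B → gridHead g ∈ B → ψ (gridTail g) = ψ (gridHead g))
    {p q : ℤ × ℤ} (hp : p ∈ B) (hq : q ∈ B) : ψ q = ψ p :=
  hB {r | ψ r = ψ p} (fun g h1 h2 => by simp [hψ g h1 h2]) p hp q hq rfl

/-- The points of `ℤ × ℤ` whose unit square meets the set `X` magnified by `N`. -/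
def gridCells (N : ℝ) (X : Set (ℝ × ℝ)) : Set (ℤ × ℤ) :=
  {p | ∃ x ∈ X, |N * x.1 - p.1| ≤ 1 / 2 ∧ |N * x.2 - p.2| ≤ 1 / 2}

theorem exists_int_abs_sub_le (a : ℝ) : ∃ i : ℤ, |a - i| ≤ 1 / 2 :=
  ⟨round a, abs_sub_round a⟩

theorem finite_gridCells {N : ℝ} {X : Set (ℝ × ℝ)} (hX : IsCompact X) :
    (gridCells N X).Finite := by
  obtain ⟨M, hM⟩ := hX.isBounded.exists_norm_le
  have key : ∀ (a : ℝ) (i : ℤ), |a| ≤ M → |N * a - i| ≤ 1 / 2 →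
      i ∈ Set.Icc (-⌈|N| * M + 1⌉) ⌈|N| * M + 1⌉ := by
    intro a i ha hi
    have h1 : |N * a| ≤ |N| * M := by rw [abs_mul]; gcongr
    have h2 := Int.le_ceil (|N| * M + 1)
    rw [abs_le] at h1 hi
    constructor
    · have : (-(⌈|N| * M + 1⌉ : ℤ) : ℝ) ≤ i := by linarith
      exact_mod_cast this
    · have : (i : ℝ) ≤ (⌈|N| * M + 1⌉ : ℤ) := by linarith
      exact_mod_cast this
  have hfin := Set.finite_Icc (-⌈|N| * M + 1⌉) ⌈|N| * M + 1⌉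
  refine (hfin.prod hfin).subset ?_
  rintro ⟨i, j⟩ ⟨x, hx, h1, h2⟩
  have h3 := hM x hx
  exact ⟨key _ _ ((norm_fst_le x).trans h3) h1, key _ _ ((norm_snd_le x).trans h3) h2⟩

theorem gridCells_inter_nonempty (N : ℝ) {X Y : Set (ℝ × ℝ)} (h : (X ∩ Y).Nonempty) :
    (gridCells N X ∩ gridCells N Y).Nonempty := by
  obtain ⟨x, hX, hY⟩ := h
  obtain ⟨i, hi⟩ := exists_int_abs_sub_le (N * x.1)
  obtain ⟨j, hj⟩ := exists_int_abs_sub_le (N * x.2)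
  exact ⟨(i, j), ⟨x, hX, hi, hj⟩, ⟨x, hY, hi, hj⟩⟩

/-- If `U` split the cells, the closed squares of the two classes would cover `X`, and connectedness
gives a point of `X` in squares of both. These squares may share only a corner, but then the square
with mixed coordinates `(a, d)` also contains the point and joins them by grid edges. -/
theorem gridPreconnected_gridCells {N : ℝ} {X : Set (ℝ × ℝ)} (hX : IsCompact X)
    (hc : IsPreconnected X) : GridPreconnected (gridCells N X) := by
  intro U hU p hp q hq hpU
  by_contra hqU
  let S : ℤ × ℤ → Set (ℝ × ℝ) := fun p => {x | |N * x.1 - p.1| ≤ 1 / 2 ∧ |N * x.2 - p.2| ≤ 1 / 2}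
  have hS : ∀ p, IsClosed (S p) := fun p => by
    have h1 : Continuous fun x : ℝ × ℝ => |N * x.1 - p.1| := by fun_prop
    have h2 : Continuous fun x : ℝ × ℝ => |N * x.2 - p.2| := by fun_prop
    exact (isClosed_le h1 continuous_const).inter (isClosed_le h2 continuous_const)
  have hfin := finite_gridCells (N := N) hX
  have hclosed : ∀ W : Set (ℤ × ℤ), IsClosed (⋃ p ∈ gridCells N X ∩ W, S p) := fun W =>
    (hfin.subset Set.inter_subset_left).isClosed_biUnion fun p _ => hS p
  have hcover : X ⊆ (⋃ p ∈ gridCells N X ∩ U, S p) ∪ ⋃ p ∈ gridCells N X ∩ Uᶜ, S p := by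
    intro x hx
    obtain ⟨i, hi⟩ := exists_int_abs_sub_le (N * x.1)
    obtain ⟨j, hj⟩ := exists_int_abs_sub_le (N * x.2)
    have hmem : (i, j) ∈ gridCells N X := ⟨x, hx, hi, hj⟩
    by_cases h : (i, j) ∈ U
    · exact Or.inl (Set.mem_biUnion (⟨hmem, h⟩ : (i, j) ∈ gridCells N X ∩ U) ⟨hi, hj⟩)
    · exact Or.inr (Set.mem_biUnion (⟨hmem, h⟩ : (i, j) ∈ gridCells N X ∩ Uᶜ) ⟨hi, hj⟩)
  obtain ⟨x, hx, hx1, hx2⟩ := isPreconnected_closed_iff.1 hc _ _ (hclosed U) (hclosed Uᶜ) hcover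
    (by
      obtain ⟨x, hx, h⟩ := hp
      exact ⟨x, hx, Set.mem_biUnion (⟨⟨x, hx, h⟩, hpU⟩ : p ∈ gridCells N X ∩ U) h⟩)
    (by
      obtain ⟨x, hx, h⟩ := hq
      exact ⟨x, hx, Set.mem_biUnion (⟨⟨x, hx, h⟩, hqU⟩ : q ∈ gridCells N X ∩ Uᶜ) h⟩)
  simp only [Set.mem_iUnion] at hx1 hx2
  obtain ⟨⟨a, b⟩, ⟨hab, habU⟩, ha, hb⟩ := hx1
  obtain ⟨⟨c, d⟩, ⟨hcd, hcdU⟩, hc, hd⟩ := hx2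
  have had : (a, d) ∈ gridCells N X := ⟨x, hx, ha, hd⟩
  have near : ∀ (r : ℝ) (k l : ℤ), |r - k| ≤ 1 / 2 → |r - l| ≤ 1 / 2 →
      k = l ∨ k = l + 1 ∨ l = k + 1 := by
    intro r k l hk hl
    rw [abs_le] at hk hl
    have h1 : (k : ℝ) < l + 2 := by linarith
    have h2 : (l : ℝ) < k + 2 := by linarith
    have h1' : k < l + 2 := by exact_mod_cast h1
    have h2' : l < k + 2 := by exact_mod_cast h2
    omega
  have hadU : (a, d) ∈ U := by
    rcases near _ _ _ hb hd with h | h | h <;> dsimp only at h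
    · rwa [← h]
    · subst h; exact (hU (a, d, true) had hab).2 habU
    · subst h; exact (hU (a, b, true) hab had).1 habU
  refine hcdU ?_
  rcases near _ _ _ ha hc with h | h | h <;> dsimp only at h
  · rwa [← h]
  · subst h; exact (hU (c, d, false) hcd had).2 hadU
  · subst h; exact (hU (a, d, false) had hcd).1 hadU

/-- Points in a common cell are at sup distance at most 1/N, while disjoint compact sets have
positive distance. -/
theorem eventually_disjoint_gridCells {X Y : Set (ℝ × ℝ)} (hX : IsCompact X) (hY : IsCompact Y)
    (h : Disjoint X Y) : ∀ᶠ N : ℝ in Filter.atTop, Disjoint (gridCells N X) (gridCells N Y) := by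
  obtain ⟨r, hr, hXY⟩ := Metric.exists_pos_forall_lt_edist hX hY.isClosed h
  filter_upwards [Filter.eventually_gt_atTop (1 / (r : ℝ)), Filter.eventually_gt_atTop 0]
    with N hN hN0
  rw [Set.disjoint_left]
  rintro ⟨i, j⟩ ⟨x, hx, hx1, hx2⟩ ⟨y, hy, hy1, hy2⟩
  have h1 := hXY x hx y hy
  rw [edist_nndist, ENNReal.coe_lt_coe] at h1
  have h2 : (r : ℝ) < dist x y := by exact_mod_cast h1
  have hr' : (0 : ℝ) < r := hr
  have key : ∀ (a b : ℝ) (k : ℤ), |N * a - k| ≤ 1 / 2 → |N * b - k| ≤ 1 / 2 →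
      dist a b ≤ 1 / N := by
    intro a b k ha hb
    rw [abs_le] at ha hb
    have h5 : |N * (a - b)| ≤ 1 := by rw [abs_le]; constructor <;> linarith
    rw [Real.dist_eq, le_div_iff₀ hN0, mul_comm]
    rwa [abs_mul, abs_of_pos hN0] at h5
  have h3 : dist x y ≤ 1 / N := by
    rw [Prod.dist_eq]
    exact max_le (key _ _ _ hx1 hy1) (key _ _ _ hx2 hy2)
  have h4 : 1 / N < r := by
    rw [div_lt_iff₀ hN0]
    rw [div_lt_iff₀ hr'] at hN
    linarith
  linarith

/-- Grid points are adjacent if they are the ends of a grid edge. -/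
def GridAdj (p q : ℤ × ℤ) : Prop :=
  ∃ g, gridTail g = p ∧ gridHead g = q ∨ gridTail g = q ∧ gridHead g = p

/-- The part of `S` that can be reached from `A` inside `S`. -/
def gridReach (A S : Set (ℤ × ℤ)) : Set (ℤ × ℤ) :=
  {p | ∃ a ∈ A, Relation.ReflTransGen (fun p q => GridAdj p q ∧ q ∈ S) a p}

theorem gridReach_subset {A S : Set (ℤ × ℤ)} (h : A ⊆ S) : gridReach A S ⊆ S := by
  rintro p ⟨a, ha, hp⟩
  cases hp with
  | refl => exact h ha
  | tail _ h => exact h.2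

theorem subset_gridReach (A S : Set (ℤ × ℤ)) : A ⊆ gridReach A S :=
  fun a ha => ⟨a, ha, .refl⟩

theorem mem_gridReach_of_adj {A S : Set (ℤ × ℤ)} {p q : ℤ × ℤ} (hp : p ∈ gridReach A S)
    (hpq : GridAdj p q) (hq : q ∈ S) : q ∈ gridReach A S := by
  obtain ⟨a, ha, h⟩ := hp
  exact ⟨a, ha, h.tail ⟨hpq, hq⟩⟩

/-- A preconnected set that meets the disjoint sets `A` and `B` has an edge from the part that can
be reached from `A` without entering `B` to `B`. -/
theorem GridPreconnected.exists_edge_gridReach {M A B : Set (ℤ × ℤ)} (hM : GridPreconnected M)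
    (hAB : Disjoint A B) (hA : (M ∩ A).Nonempty) (hB : (M ∩ B).Nonempty) :
    ∃ g, gridTail g ∈ M ∧ gridHead g ∈ M ∧
      (gridTail g ∈ gridReach (M ∩ A) (M \ B) ∧ gridHead g ∈ B ∨
        gridHead g ∈ gridReach (M ∩ A) (M \ B) ∧ gridTail g ∈ B) := by
  by_contra! hcon
  obtain ⟨a, haM, haA⟩ := hA
  obtain ⟨b, hbM, hbB⟩ := hB
  have hsub : gridReach (M ∩ A) (M \ B) ⊆ M \ B :=
    gridReach_subset fun x hx => ⟨hx.1, Set.disjoint_left.1 hAB hx.2⟩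
  refine (hsub (hM (gridReach (M ∩ A) (M \ B)) (fun g h1 h2 => ⟨fun h => ?_, fun h => ?_⟩) a haM
    b hbM (subset_gridReach _ _ ⟨haM, haA⟩))).2 hbB
  · exact mem_gridReach_of_adj h ⟨g, .inl ⟨rfl, rfl⟩⟩ ⟨h2, (hcon g h1 h2).1 h⟩
  · exact mem_gridReach_of_adj h ⟨g, .inr ⟨rfl, rfl⟩⟩ ⟨h1, (hcon g h1 h2).2 h⟩

/-- Each added point is joined inside the union to a point of `B`. -/
theorem GridPreconnected.union_gridReach {ι : Type*} {B : Set (ℤ × ℤ)} (hB : GridPreconnected B)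
    {J : Set ι} {A S : ι → Set (ℤ × ℤ)} (hA : ∀ i ∈ J, A i ⊆ B) :
    GridPreconnected (B ∪ ⋃ i ∈ J, gridReach (A i) (S i)) := by
  intro U hU
  have hback : ∀ p ∈ B ∪ ⋃ i ∈ J, gridReach (A i) (S i), ∃ b ∈ B, (p ∈ U ↔ b ∈ U) := by
    rintro p (hp | hp)
    · exact ⟨p, hp, Iff.rfl⟩
    · simp only [Set.mem_iUnion] at hp
      obtain ⟨i, hi, a, ha, hp⟩ := hp
      refine ⟨a, hA i hi ha, ?_⟩
      have hmem : ∀ q, Relation.ReflTransGen (fun p q => GridAdj p q ∧ q ∈ S i) a q →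
          q ∈ B ∪ ⋃ i ∈ J, gridReach (A i) (S i) :=
        fun q hq => Or.inr (Set.mem_biUnion hi ⟨a, ha, hq⟩)
      induction hp with
      | refl => rfl
      | tail h1 h2 ih =>
        refine Iff.trans ?_ ih
        have m1 := hmem _ h1
        have m2 := hmem _ (h1.tail h2)
        obtain ⟨⟨g, ⟨rfl, rfl⟩ | ⟨rfl, rfl⟩⟩, -⟩ := h2
        · exact (hU g m1 m2).symm
        · exact hU g m2 m1
  intro p hp q hq hpU
  obtain ⟨b, hb, hpb⟩ := hback p hp
  obtain ⟨c, hc, hqc⟩ := hback q hq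
  exact hqc.2 (hB U (fun g h1 h2 => hU g (.inl h1) (.inl h2)) b hb c hc (hpb.1 hpU))

end GridConnectivity

/-! ### From plane drawings to grid minors -/

section GridMinor

variable {α β : Type*}

/-- A realization of the edges in `E` of a multigraph as a minor of the square grid: disjoint
connected branch sets for the vertices, and a grid edge between branch sets for every edge. -/
structure Graph.GridMinor (G : Graph α β) (E : Set β) where
  branch : α → Set (ℤ × ℤ)
  edge : β → ℤ × ℤ × Bool
  tail : β → α
  head : β → α
  finite_branch : ∀ v ∈ G.vertexSet, (branch v).Finite
  nonempty_branch : ∀ v ∈ G.vertexSet, (branch v).Nonempty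
  gridPreconnected_branch : ∀ v ∈ G.vertexSet, GridPreconnected (branch v)
  disjoint_branch : G.vertexSet.PairwiseDisjoint branch
  edge_injOn : Set.InjOn edge E
  isLink : ∀ e ∈ E, G.IsLink e (tail e) (head e)
  gridTail_mem : ∀ e ∈ E, gridTail (edge e) ∈ branch (tail e)
  gridHead_mem : ∀ e ∈ E, gridHead (edge e) ∈ branch (head e)

/-- Connected sets of grid points for the vertices and for the edges give a grid minor, if the set
of an edge meets no other such set than those of its two ends. -/
theorem Graph.nonempty_gridMinor [Nonempty α] (G : Graph α β) {E : Set β} (hE : E.Finite) (src tgt : β → α)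
    (hlink : ∀ e ∈ E, G.IsLink e (src e) (tgt e)) (hne : ∀ e ∈ E, src e ≠ tgt e)
    (B : α → Set (ℤ × ℤ)) (M : β → Set (ℤ × ℤ))
    (hBfin : ∀ v ∈ G.vertexSet, (B v).Finite) (hBne : ∀ v ∈ G.vertexSet, (B v).Nonempty)
    (hB : ∀ v ∈ G.vertexSet, GridPreconnected (B v))
    (hMfin : ∀ e ∈ E, (M e).Finite) (hM : ∀ e ∈ E, GridPreconnected (M e))
    (hBB : G.vertexSet.PairwiseDisjoint B) (hMM : E.PairwiseDisjoint M)
    (hMB : ∀ e ∈ E, ∀ v ∈ G.vertexSet, v ≠ src e → v ≠ tgt e → Disjoint (M e) (B v))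
    (hMs : ∀ e ∈ E, (M e ∩ B (src e)).Nonempty) (hMt : ∀ e ∈ E, (M e ∩ B (tgt e)).Nonempty) :
    Nonempty (G.GridMinor E) := by
  have hsV : ∀ e ∈ E, src e ∈ G.vertexSet := fun e he => (hlink e he).left_mem
  have htV : ∀ e ∈ E, tgt e ∈ G.vertexSet := fun e he => (hlink e he).right_mem
  have hdis : ∀ e ∈ E, Disjoint (B (src e)) (B (tgt e)) := fun e he =>
    hBB (hsV e he) (htV e he) (hne e he)
  -- The part of `M e` reachable from the source before entering the target set is absorbed by the
  -- source; a grid edge then leads from it into the target set.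
  let P : β → Set (ℤ × ℤ) := fun e => gridReach (M e ∩ B (src e)) (M e \ B (tgt e))
  have hP : ∀ e ∈ E, P e ⊆ M e \ B (tgt e) := fun e he =>
    gridReach_subset fun x hx => ⟨hx.1, Set.disjoint_left.1 (hdis e he) hx.2⟩
  let B' : α → Set (ℤ × ℤ) := fun v => B v ∪ ⋃ e ∈ {e | e ∈ E ∧ src e = v}, P e
  have hB' : ∀ v p, p ∈ B' v ↔ p ∈ B v ∨ ∃ e ∈ E, src e = v ∧ p ∈ P e := by
    intro v p
    simp only [B', Set.mem_union, Set.mem_iUnion, Set.mem_ofPred_eq, exists_prop, and_assoc]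
  have hPB : ∀ e ∈ E, ∀ v ∈ G.vertexSet, v ≠ src e → ∀ p ∈ P e, p ∉ B v := by
    intro e he v hv hvs p hp hpv
    by_cases hvt : v = tgt e
    · subst hvt; exact (hP e he hp).2 hpv
    · exact Set.disjoint_left.1 (hMB e he v hv hvs hvt) (hP e he hp).1 hpv
  have hPP : ∀ e ∈ E, ∀ f ∈ E, src e ≠ src f → ∀ p ∈ P e, p ∉ P f := by
    intro e he f hf hef p hp hp'
    exact Set.disjoint_left.1 (hMM he hf (fun h => hef (h ▸ rfl))) (hP e he hp).1 (hP f hf hp').1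
  -- The grid edge may point either way, so its tail can belong to either end. Recording that the
  -- tail lies in `M e` makes the choice injective, since these sets are disjoint.
  have hedge : ∀ e ∈ E, ∃ (g : ℤ × ℤ × Bool) (x y : α), gridTail g ∈ M e ∧ G.IsLink e x y ∧
      gridTail g ∈ B' x ∧ gridHead g ∈ B' y := by
    intro e he
    obtain ⟨g, h1, h2, ⟨h3, h4⟩ | ⟨h3, h4⟩⟩ :=
      (hM e he).exists_edge_gridReach (hdis e he) (hMs e he) (hMt e he)
    · exact ⟨g, src e, tgt e, h1, hlink e he, (hB' _ _).2 (.inr ⟨e, he, rfl, h3⟩),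
        (hB' _ _).2 (.inl h4)⟩
    · exact ⟨g, tgt e, src e, h1, (hlink e he).symm, (hB' _ _).2 (.inl h4),
        (hB' _ _).2 (.inr ⟨e, he, rfl, h3⟩)⟩
  choose! g x y hg hxy hx hy using hedge
  refine ⟨⟨B', g, x, y, fun v hv => ?_, fun v hv => ?_, fun v hv => ?_, fun v hv w hw hvw => ?_,
    fun e he f hf hef => ?_, hxy, hx, hy⟩⟩
  · refine (hBfin v hv).union ?_
    refine (hE.subset fun e he => he.1).biUnion fun e he => ?_
    exact (hMfin e he.1).subset fun p hp => (hP e he.1 hp).1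
  · exact (hBne v hv).mono Set.subset_union_left
  · refine (hB v hv).union_gridReach fun e he => ?_
    obtain ⟨_, rfl⟩ := he
    exact Set.inter_subset_right
  · refine Set.disjoint_left.2 fun p hp hp' => ?_
    rw [hB'] at hp hp'
    rcases hp with hp | ⟨e, he, rfl, hp⟩ <;> rcases hp' with hp' | ⟨f, hf, rfl, hp'⟩
    · exact Set.disjoint_left.1 (hBB hv hw hvw) hp hp'
    · exact hPB f hf v hv hvw p hp' hp
    · exact hPB e he w hw hvw.symm p hp hp'
    · exact hPP e he f hf hvw p hp hp'
  · by_contra hne'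
    refine Set.disjoint_left.1 (hMM he hf hne') (hg e he) ?_
    rw [hef]
    exact hg f hf

/-- The edges of a multigraph that are not loops. -/
def Graph.nonloops (G : Graph α β) : Set β := {e | e ∈ G.edgeSet ∧ ∀ x, ¬ G.IsLink e x x}

/-- The non-loops of a finite plane multigraph form a minor of the square grid. -/
theorem Graph.PlaneDrawing.nonempty_gridMinor [Nonempty α] {G : Graph α β} (𝒟 : G.PlaneDrawing)
    (hV : G.vertexSet.Finite) (hfinE : G.edgeSet.Finite) :
    Nonempty (G.GridMinor G.nonloops) := by
  let E := G.nonloops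
  have hE : E.Finite := hfinE.subset fun e he => he.1
  choose! src tgt hlink h0 h1 using 𝒟.curve_ends
  let π : EuclideanSpace ℝ (Fin 2) → ℝ × ℝ := fun x => (x 0, x 1)
  have hπc : Continuous π := by fun_prop
  have hπ : Function.Injective π := by
    intro x y hxy
    ext i
    simp only [π, Prod.mk.injEq] at hxy
    fin_cases i
    · exact hxy.1
    · exact hxy.2
  let pt : α → ℝ × ℝ := fun v => π (𝒟.point v)
  let c : β → ℝ → ℝ × ℝ := fun e t => π (𝒟.curve e (Set.projIcc 0 1 zero_le_one t))
  have hc : ∀ e, Continuous (c e) := fun e => by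
    exact hπc.comp ((𝒟.curve e).continuous.comp continuous_projIcc)
  have hc0 : ∀ e ∈ E, c e 0 = pt (src e) := fun e he => by
    simp only [c, pt, Set.projIcc_left, ← h0 e he.1]; rfl
  have hc1 : ∀ e ∈ E, c e 1 = pt (tgt e) := fun e he => by
    simp only [c, pt, Set.projIcc_right, ← h1 e he.1]; rfl
  have hproj : ∀ t ∈ Set.Ioo (0 : ℝ) 1, Set.projIcc (0 : ℝ) 1 zero_le_one t ∈
      Set.Ioo (0 : unitInterval) 1 := by
    intro t ht
    rw [Set.projIcc_of_mem _ (Set.Ioo_subset_Icc_self ht)]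
    exact ⟨ht.1, ht.2⟩
  have hcpt : ∀ e ∈ E, ∀ t ∈ Set.Ioo (0 : ℝ) 1, ∀ v ∈ G.vertexSet, c e t ≠ pt v :=
    fun e he t ht v hv h => 𝒟.curve_ne_point e he.1 _ (hproj t ht) v hv (hπ h)
  have hcc : ∀ e ∈ E, ∀ t ∈ Set.Ioo (0 : ℝ) 1, ∀ f ∈ E, ∀ s ∈ Set.Ioo (0 : ℝ) 1,
      c e t = c f s → e = f ∧ t = s := by
    intro e he t ht f hf s hs h
    have h' := hπ h
    have hef : e = f := by
      by_contra hef
      exact Set.disjoint_left.1 (𝒟.curve_disjoint e he.1 f hf.1 hef)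
        (Set.mem_image_of_mem _ (hproj t ht)) (h' ▸ Set.mem_image_of_mem _ (hproj s hs))
    subst hef
    have := 𝒟.curve_injOn e he.1 (hproj t ht) (hproj s hs) h'
    rw [Set.projIcc_of_mem _ (Set.Ioo_subset_Icc_self ht),
      Set.projIcc_of_mem _ (Set.Ioo_subset_Icc_self hs)] at this
    exact ⟨rfl, congrArg Subtype.val this⟩
  have hptpt : ∀ v ∈ G.vertexSet, ∀ w ∈ G.vertexSet, pt v = pt w → v = w :=
    fun v hv w hw h => 𝒟.point_injOn hv hw (hπ h)
  -- Each curve is cut into thirds: the outer thirds join the sets of the end vertices, and the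
  -- middle third represents the edge. All these sets are compact and connected, and they meet only
  -- where an edge meets its ends.
  let X : α → Set (ℝ × ℝ) := fun v => {pt v} ∪
    ((⋃ e ∈ {e | e ∈ E ∧ src e = v}, c e '' Set.Icc 0 (1 / 3)) ∪
      ⋃ e ∈ {e | e ∈ E ∧ tgt e = v}, c e '' Set.Icc (2 / 3) 1)
  let M : β → Set (ℝ × ℝ) := fun e => c e '' Set.Icc (1 / 3) (2 / 3)
  have hXmem : ∀ v z, z ∈ X v ↔ z = pt v ∨ (∃ e, (e ∈ E ∧ src e = v) ∧
      z ∈ c e '' Set.Icc 0 (1 / 3)) ∨ ∃ e, (e ∈ E ∧ tgt e = v) ∧ z ∈ c e '' Set.Icc (2 / 3) 1 := by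
    intro v z
    simp only [X, Set.mem_union, Set.mem_singleton_iff, Set.mem_iUnion, Set.mem_ofPred_eq,
      exists_prop]
  have hXelim : ∀ v z, z ∈ X v → z = pt v ∨ ∃ e ∈ E, ∃ t ∈ Set.Ioo (0 : ℝ) 1, z = c e t ∧
      (src e = v ∧ t ≤ 1 / 3 ∨ tgt e = v ∧ 2 / 3 ≤ t) := by
    intro v z hz
    rcases (hXmem v z).1 hz with h | ⟨e, ⟨he, rfl⟩, t, ht, rfl⟩ | ⟨e, ⟨he, rfl⟩, t, ht, rfl⟩
    · exact .inl h
    · rcases ht.1.eq_or_lt with h | h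
      · exact .inl (h ▸ hc0 e he)
      · exact .inr ⟨e, he, t, ⟨h, by linarith [ht.2]⟩, rfl, .inl ⟨rfl, ht.2⟩⟩
    · rcases ht.2.eq_or_lt with h | h
      · exact .inl (h ▸ hc1 e he)
      · exact .inr ⟨e, he, t, ⟨by linarith [ht.1], h⟩, rfl, .inr ⟨rfl, ht.1⟩⟩
  have hMelim : ∀ e z, z ∈ M e → ∃ t ∈ Set.Ioo (0 : ℝ) 1, z = c e t ∧ 1 / 3 ≤ t ∧ t ≤ 2 / 3 := by
    rintro e z ⟨t, ht, rfl⟩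
    exact ⟨t, ⟨by linarith [ht.1], by linarith [ht.2]⟩, rfl, ht.1, ht.2⟩
  have hne : ∀ e ∈ E, src e ≠ tgt e := fun e he h => by
    have := hlink e he.1
    rw [h] at this
    exact he.2 _ this
  have hXX : ∀ v ∈ G.vertexSet, ∀ w ∈ G.vertexSet, v ≠ w → Disjoint (X v) (X w) := by
    intro v hv w hw hvw
    refine Set.disjoint_left.2 fun z hz hz' => ?_
    rcases hXelim v z hz with rfl | ⟨e, he, t, ht, rfl, h⟩ <;>
      rcases hXelim w _ hz' with h' | ⟨f, hf, s, hs, h', h''⟩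
    · exact hvw (hptpt v hv w hw h')
    · exact hcpt f hf s hs v hv h'.symm
    · exact hcpt e he t ht w hw h'
    · obtain ⟨rfl, rfl⟩ := hcc e he t ht f hf s hs h'
      rcases h with ⟨rfl, h⟩ | ⟨rfl, h⟩ <;> rcases h'' with ⟨rfl, h''⟩ | ⟨rfl, h''⟩
      · exact hvw rfl
      · linarith
      · linarith
      · exact hvw rfl
  have hMX : ∀ e ∈ E, ∀ v ∈ G.vertexSet, v ≠ src e → v ≠ tgt e → Disjoint (M e) (X v) := by
    intro e he v hv hs ht
    refine Set.disjoint_left.2 fun z hz hz' => ?_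
    obtain ⟨t, ht01, rfl, -⟩ := hMelim e z hz
    rcases hXelim v _ hz' with h' | ⟨f, hf, s, hs01, h', h''⟩
    · exact hcpt e he t ht01 v hv h'
    · obtain ⟨rfl, rfl⟩ := hcc e he t ht01 f hf s hs01 h'
      rcases h'' with ⟨rfl, -⟩ | ⟨rfl, -⟩
      · exact hs rfl
      · exact ht rfl
  have hMM : ∀ e ∈ E, ∀ f ∈ E, e ≠ f → Disjoint (M e) (M f) := by
    intro e he f hf hef
    refine Set.disjoint_left.2 fun z hz hz' => ?_
    obtain ⟨t, ht, rfl, -⟩ := hMelim e z hz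
    obtain ⟨s, hs, h, -⟩ := hMelim f _ hz'
    exact hef (hcc e he t ht f hf s hs h).1
  have hXcpt : ∀ v, IsCompact (X v) := fun v => by
    refine isCompact_singleton.union (IsCompact.union ?_ ?_)
    · exact (hE.subset fun e he => he.1).isCompact_biUnion fun e _ =>
        isCompact_Icc.image (hc e)
    · exact (hE.subset fun e he => he.1).isCompact_biUnion fun e _ =>
        isCompact_Icc.image (hc e)
  have hMcpt : ∀ e, IsCompact (M e) := fun e => isCompact_Icc.image (hc e)
  have hXconn : ∀ v, IsPreconnected (X v) := fun v => by
    refine isPreconnected_of_forall (pt v) fun z hz => ?_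
    rcases (hXmem v z).1 hz with rfl | ⟨e, ⟨he, hev⟩, hz⟩ | ⟨e, ⟨he, hev⟩, hz⟩
    · exact ⟨{pt v}, by simpa using hz, rfl, rfl, isPreconnected_singleton⟩
    · refine ⟨c e '' Set.Icc 0 (1 / 3), fun w hw => (hXmem v w).2 (.inr (.inl ⟨e, ⟨he, hev⟩, hw⟩)),
        ⟨0, by norm_num, by rw [hc0 e he, hev]⟩, hz,
        isPreconnected_Icc.image _ (hc e).continuousOn⟩
    · refine ⟨c e '' Set.Icc (2 / 3) 1, fun w hw => (hXmem v w).2 (.inr (.inr ⟨e, ⟨he, hev⟩, hw⟩)),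
        ⟨1, by norm_num, by rw [hc1 e he, hev]⟩, hz,
        isPreconnected_Icc.image _ (hc e).continuousOn⟩
  have hMconn : ∀ e, IsPreconnected (M e) := fun e =>
    isPreconnected_Icc.image _ (hc e).continuousOn
  -- Only finitely many pairs must be separated, so one scale `N` serves all.
  have ev1 : ∀ᶠ N : ℝ in Filter.atTop, ∀ v ∈ G.vertexSet, ∀ w ∈ G.vertexSet, v ≠ w →
      Disjoint (gridCells N (X v)) (gridCells N (X w)) := by
    rw [hV.eventually_all]; intro v hv
    rw [hV.eventually_all]; intro w hw
    rw [Filter.eventually_imp_distrib_left]; intro hvw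
    exact eventually_disjoint_gridCells (hXcpt v) (hXcpt w) (hXX v hv w hw hvw)
  have ev2 : ∀ᶠ N : ℝ in Filter.atTop, ∀ e ∈ E, ∀ v ∈ G.vertexSet, v ≠ src e → v ≠ tgt e →
      Disjoint (gridCells N (M e)) (gridCells N (X v)) := by
    rw [hE.eventually_all]; intro e he
    rw [hV.eventually_all]; intro v hv
    rw [Filter.eventually_imp_distrib_left]; intro h
    rw [Filter.eventually_imp_distrib_left]; intro h'
    exact eventually_disjoint_gridCells (hMcpt e) (hXcpt v) (hMX e he v hv h h')
  have ev3 : ∀ᶠ N : ℝ in Filter.atTop, ∀ e ∈ E, ∀ f ∈ E, e ≠ f →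
      Disjoint (gridCells N (M e)) (gridCells N (M f)) := by
    rw [hE.eventually_all]; intro e he
    rw [hE.eventually_all]; intro f hf
    rw [Filter.eventually_imp_distrib_left]; intro h
    exact eventually_disjoint_gridCells (hMcpt e) (hMcpt f) (hMM e he f hf h)
  obtain ⟨N, ev1, ev2, ev3⟩ := (ev1.and (ev2.and ev3)).exists
  refine G.nonempty_gridMinor hE src tgt (fun e he => hlink e he.1) hne
    (fun v => gridCells N (X v)) (fun e => gridCells N (M e))
    (fun v _ => finite_gridCells (hXcpt v)) (fun v _ => ?_)
    (fun v _ => gridPreconnected_gridCells (hXcpt v) (hXconn v))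
    (fun e _ => finite_gridCells (hMcpt e))
    (fun e _ => gridPreconnected_gridCells (hMcpt e) (hMconn e))
    (fun v hv w hw => ev1 v hv w hw) (fun e he f hf => ev3 e he f hf) ev2
    (fun e he => ?_) (fun e he => ?_)
  · have hmem : pt v ∈ X v := (hXmem v _).2 (.inl rfl)
    exact (gridCells_inter_nonempty N ⟨pt v, hmem, hmem⟩).mono Set.inter_subset_left
  · refine gridCells_inter_nonempty N ⟨c e (1 / 3), Set.mem_image_of_mem _ (by norm_num), ?_⟩
    exact (hXmem _ _).2 (.inr (.inl ⟨e, ⟨he, rfl⟩, Set.mem_image_of_mem _ (by norm_num)⟩))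
  · refine gridCells_inter_nonempty N ⟨c e (2 / 3), Set.mem_image_of_mem _ (by norm_num), ?_⟩
    exact (hXmem _ _).2 (.inr (.inr ⟨e, ⟨he, rfl⟩, Set.mem_image_of_mem _ (by norm_num)⟩))

end GridMinor

/-! ### Spanning trees against cuts and flows -/

section SpanningTrees

variable {α β : Type*}

theorem Graph.IsConnected.eq_of_forall_isLink {T : Graph α β} (hT : T.IsConnected) {φ : α → ℚ}
    (hφ : ∀ e x y, T.IsLink e x y → φ x = φ y) {x y : α} (hx : x ∈ T.vertexSet)
    (hy : y ∈ T.vertexSet) : φ x = φ y := by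
  have h := hT.2 x hx y hy
  induction h with
  | refl => rfl
  | tail _ h ih =>
    obtain ⟨e, he⟩ := h
    rw [ih he.left_mem, hφ e _ _ he]

/-- A path from `y` to `x` and a further edge from `x` to `y` form a cycle. -/
theorem Graph.HasNoCycle.false_of_path {T : Graph α β} (hT : T.HasNoCycle) {H : SimpleGraph α}
    {e₀ : β} (hH : ∀ u w, H.Adj u w → ∃ e, e ≠ e₀ ∧ T.IsLink e u w) {x y : α}
    (he₀ : T.IsLink e₀ x y) (p : H.Walk y x) (hp : p.IsPath) : False := by
  have : Nonempty β := ⟨e₀⟩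
  choose! f hf0 hf using hH
  -- The edge `e₀` takes the last index, where the successor wraps around to 0.
  let v : Fin (p.length + 1) → α := fun i => p.getVert i
  let e : Fin (p.length + 1) → β := fun i =>
    if (i : ℕ) < p.length then f (p.getVert i) (p.getVert (i + 1)) else e₀
  have hadj : ∀ i, i < p.length → H.Adj (p.getVert i) (p.getVert (i + 1)) := fun i hi =>
    p.adj_getVert_succ hi
  have hinj : ∀ i j, i ≤ p.length → j ≤ p.length → p.getVert i = p.getVert j → i = j :=
    fun i j hi hj h => hp.getVert_injOn hi hj h
  refine hT p.length v e ⟨fun i j h => ?_, fun i j h => ?_, fun i => ?_⟩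
  · exact Fin.ext (hinj _ _ (by omega) (by omega) h)
  · simp only [e] at h
    split_ifs at h with hi hj hj
    · have h1 := hf _ _ (hadj _ hi)
      rw [h] at h1
      rcases h1.eq_and_eq_or_eq_and_eq (hf _ _ (hadj _ hj)) with ⟨h2, -⟩ | ⟨h2, h3⟩
      · exact Fin.ext (hinj _ _ (by omega) (by omega) h2)
      -- The same edge traversed backwards would force i = j + 1 and i + 1 = j.
      · have := hinj _ _ (by omega) (by omega) h2
        have := hinj _ _ (by omega) (by omega) h3
        omega
    · exact absurd h (hf0 _ _ (hadj _ hi))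
    · exact absurd h.symm (hf0 _ _ (hadj _ hj))
    · exact Fin.ext (by omega)
  · by_cases hi : (i : ℕ) < p.length
    · have h1 : ((i + 1 : Fin (p.length + 1)) : ℕ) = i + 1 :=
        Fin.val_add_one_of_lt (by rw [Fin.lt_def]; exact hi)
      simp only [v, e, hi, if_true, h1]
      exact hf _ _ (hadj _ hi)
    · have h0 : i = Fin.last _ := Fin.ext (by simp; omega)
      subst h0
      simpa [v, e] using he₀

/-- Test the flow against the indicator of the component of `tgt e₀` after removing `e₀`. Without
cycles `src e₀` lies outside it, so `e₀` alone contributes to the sum. -/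
theorem Graph.HasNoCycle.eq_zero_of_flow {T : Graph α β} (hT : T.HasNoCycle) {S : Finset β}
    {src tgt : β → α} (hlink : ∀ e ∈ S, T.IsLink e (src e) (tgt e)) {z : β → ℚ}
    (hz : ∀ φ : α → ℚ, ∑ e ∈ S, z e * (φ (tgt e) - φ (src e)) = 0) {e₀ : β} (he₀ : e₀ ∈ S) :
    z e₀ = 0 := by
  classical
  let H : SimpleGraph α :=
    { Adj := fun u w => u ≠ w ∧ ∃ e ∈ S, e ≠ e₀ ∧ T.IsLink e u w
      symm := ⟨fun u w ⟨h, e, he, he', hl⟩ => ⟨h.symm, e, he, he', hl.symm⟩⟩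
      loopless := ⟨fun u h => h.1 rfl⟩ }
  have hnot : ¬ H.Reachable (tgt e₀) (src e₀) := by
    rintro ⟨p⟩
    exact hT.false_of_path (H := H) (fun u w h => by
      obtain ⟨-, e, -, he, hl⟩ := h
      exact ⟨e, he, hl⟩) (hlink e₀ he₀) p.toPath.1 p.toPath.2
  have h1 := hz fun w => if H.Reachable (tgt e₀) w then 1 else 0
  rw [Finset.sum_eq_single_of_mem e₀ he₀] at h1
  · simpa [hnot, SimpleGraph.Reachable.refl] using h1
  · intro e he hne
    have : H.Reachable (tgt e₀) (tgt e) ↔ H.Reachable (tgt e₀) (src e) := by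
      by_cases h : src e = tgt e
      · rw [h]
      · have hadj : H.Adj (src e) (tgt e) := ⟨h, e, he, hne, hlink e he⟩
        exact ⟨fun h => h.trans hadj.symm.reachable, fun h => h.trans hadj.reachable⟩
    simp [this]

theorem Graph.edgeSet_subset_nonloops {G T : Graph α β} (hT : T ∈ G.spanningTrees) :
    T.edgeSet ⊆ G.nonloops := by
  intro e he
  refine ⟨hT.1.le.edgeSet_mono he, fun x hx => ?_⟩
  have hl := (hT.1.le.isLink_iff he).2 hx
  refine hT.2.2 0 (fun _ => x) (fun _ => e) ⟨?_, ?_, fun _ => hl⟩ <;>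
    exact fun i j _ => Subsingleton.elim (α := Fin 1) i j

theorem Graph.eq_of_edgeSet_eq {G S T : Graph α β} (hS : S ∈ G.spanningTrees)
    (hT : T ∈ G.spanningTrees) (h : S.edgeSet = T.edgeSet) : S = T := by
  refine Graph.ext (hS.1.vertexSet_eq.trans hT.1.vertexSet_eq.symm) fun e x y => ?_
  constructor
  · intro he
    exact (hT.1.le.isLink_iff (h ▸ he.edge_mem)).2 (he.mono hS.1.le)
  · intro he
    exact (hS.1.le.isLink_iff (h ▸ he.edge_mem)).2 (he.mono hT.1.le)

/-! ### Transfer between the multigraph and the grid -/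

namespace Graph.GridMinor

variable {G : Graph α β} {E : Set β} (𝒢 : G.GridMinor E)

/-- The grid edges inside the branch sets. -/
def inner : Set (ℤ × ℤ × Bool) :=
  {g | ∃ v ∈ G.vertexSet, gridTail g ∈ 𝒢.branch v ∧ gridHead g ∈ 𝒢.branch v}

theorem finite_inner (hV : G.vertexSet.Finite) : 𝒢.inner.Finite := by
  refine ((hV.biUnion fun v hv => 𝒢.finite_branch v hv).prod (Set.finite_univ (α := Bool))
    |>.image fun q => (q.1.1, q.1.2, q.2)).subset ?_
  rintro ⟨i, j, b⟩ ⟨v, hv, h, -⟩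
  exact ⟨((i, j), b), ⟨Set.mem_biUnion hv h, trivial⟩, rfl⟩

theorem eq_of_mem_branch {v w : α} (hv : v ∈ G.vertexSet) (hw : w ∈ G.vertexSet) {p : ℤ × ℤ}
    (hpv : p ∈ 𝒢.branch v) (hpw : p ∈ 𝒢.branch w) : v = w := by
  by_contra h
  exact Set.disjoint_left.1 (𝒢.disjoint_branch hv hw h) hpv hpw

theorem edge_notMem_inner (hE : E ⊆ G.nonloops) {e : β} (he : e ∈ E) :
    𝒢.edge e ∉ 𝒢.inner := by
  rintro ⟨v, hv, h1, h2⟩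
  have hl := 𝒢.isLink e he
  have ht := 𝒢.eq_of_mem_branch hv hl.left_mem h1 (𝒢.gridTail_mem e he)
  have hh := 𝒢.eq_of_mem_branch hv hl.right_mem h2 (𝒢.gridHead_mem e he)
  rw [← ht, ← hh] at hl
  exact (hE he).2 v hl

/-- A potential on the grid that is constant on branch sets comes from a potential on the
vertices. -/
theorem exists_potential {ψ : ℤ × ℤ → ℚ}
    (hψ : ∀ g ∈ 𝒢.inner, coboundary gridTail gridHead ψ g = 0) :
    ∃ φ : α → ℚ, ∀ e ∈ E,
      coboundary gridTail gridHead ψ (𝒢.edge e) = φ (𝒢.head e) - φ (𝒢.tail e) := by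
  choose! r hr using 𝒢.nonempty_branch
  refine ⟨fun v => ψ (r v), fun e he => ?_⟩
  have key : ∀ v ∈ G.vertexSet, ∀ p ∈ 𝒢.branch v, ψ p = ψ (r v) := fun v hv p hp => by
    refine (𝒢.gridPreconnected_branch v hv).eq_of_forall_edge (fun g h1 h2 => ?_) (hr v hv) hp
    have := hψ g ⟨v, hv, h1, h2⟩
    rw [coboundary_apply] at this
    linarith
  have hl := 𝒢.isLink e he
  rw [coboundary_apply, key _ hl.left_mem _ (𝒢.gridTail_mem e he),
    key _ hl.right_mem _ (𝒢.gridHead_mem e he)]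

/-- A potential on the vertices comes from a potential on the grid that is constant on branch
sets. -/
theorem exists_grid_potential (φ : α → ℚ) :
    ∃ ψ : ℤ × ℤ → ℚ, (∀ g ∈ 𝒢.inner, coboundary gridTail gridHead ψ g = 0) ∧
      ∀ e ∈ E, coboundary gridTail gridHead ψ (𝒢.edge e) = φ (𝒢.head e) - φ (𝒢.tail e) := by
  classical
  let ψ : ℤ × ℤ → ℚ := fun p =>
    if h : ∃ v ∈ G.vertexSet, p ∈ 𝒢.branch v then φ h.choose else 0
  have key : ∀ v ∈ G.vertexSet, ∀ p ∈ 𝒢.branch v, ψ p = φ v := fun v hv p hp => by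
    have h : ∃ v ∈ G.vertexSet, p ∈ 𝒢.branch v := ⟨v, hv, hp⟩
    have := h.choose_spec
    simp only [ψ, dif_pos h, 𝒢.eq_of_mem_branch this.1 hv this.2 hp]
  refine ⟨ψ, ?_, fun e he => ?_⟩
  · rintro g ⟨v, hv, h1, h2⟩
    rw [coboundary_apply, key v hv _ h1, key v hv _ h2, sub_self]
  · have hl := 𝒢.isLink e he
    rw [coboundary_apply, key _ hl.left_mem _ (𝒢.gridTail_mem e he),
      key _ hl.right_mem _ (𝒢.gridHead_mem e he)]

/-- A minor of the multigraph is a minor of the grid: contract the inner edges along with `C`, keep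
`R`, delete the rest. A small cut found there gives a nonconstant potential on the vertices, which a
tree avoiding the cut and `D` would force to be constant. A small flow gives a nonzero flow on `A ∪
C`, which no tree can contain. -/
theorem ncard_spanningTrees_le (𝒢 : G.GridMinor G.nonloops) (hV : G.vertexSet.Finite)
    (hfin : G.nonloops.Finite) {τ : ℝ} (hτ : 1 ≤ τ) (hτ3 : τ ^ 2 + τ + 1 ≤ τ ^ 3) :
    (G.spanningTrees.ncard : ℝ) ≤ τ ^ G.nonloops.ncard := by
  classical
  obtain ⟨E, hE⟩ : ∃ E : Finset β, (E : Set β) = G.nonloops := ⟨hfin.toFinset, by simp⟩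
  have hEmem : ∀ e, e ∈ E ↔ e ∈ G.nonloops := fun e => by rw [← hE]; rfl
  rw [← hE, Set.ncard_coe_finset]
  let 𝒯 : Finset (Finset β) := E.powerset.filter fun S => ∃ T ∈ G.spanningTrees, T.edgeSet = S
  have h𝒯 : ∀ S ∈ 𝒯, ∃ T ∈ G.spanningTrees, ∀ e, e ∈ T.edgeSet ↔ e ∈ S := by
    intro S hS
    obtain ⟨T, hT, h⟩ := (Finset.mem_filter.1 hS).2
    exact ⟨T, hT, fun e => by rw [h]; rfl⟩
  have hcard : G.spanningTrees.ncard ≤ 𝒯.card := by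
    rw [← Set.ncard_coe_finset 𝒯]
    have hcoe : ∀ T ∈ G.spanningTrees, ((E.filter (· ∈ T.edgeSet) : Finset β) : Set β) =
        T.edgeSet := by
      intro T hT
      ext e
      rw [Finset.mem_coe, Finset.mem_filter, hEmem]
      exact ⟨fun h => h.2, fun h => ⟨Graph.edgeSet_subset_nonloops hT h, h⟩⟩
    refine Set.ncard_le_ncard_of_injOn (fun T : Graph α β => E.filter (· ∈ T.edgeSet)) ?_ ?_
      (Finset.finite_toSet _)
    · intro T hT
      refine Finset.mem_coe.2 (Finset.mem_filter.2 ⟨?_, T, hT, (hcoe T hT).symm⟩)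
      exact Finset.mem_powerset.2 (Finset.filter_subset _ _)
    · intro S hS T hT h
      refine Graph.eq_of_edgeSet_eq hS hT ?_
      rw [← hcoe S hS, ← hcoe T hT]
      exact congrArg _ h
  refine (Nat.cast_le.2 hcard).trans (Finset.card_le_pow_of_small_sets hτ hτ3 E 𝒯
    (fun S hS => Finset.mem_powerset.1 (Finset.mem_filter.1 hS).1) ?_)
  intro C D hC hD hCD hR
  set R := E \ (C ∪ D) with hRdef
  have hRE : R ⊆ E := Finset.sdiff_subset
  have hinj : Set.InjOn 𝒢.edge (E : Set β) := by rw [hE]; exact 𝒢.edge_injOn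
  obtain ⟨K, hK⟩ : ∃ K : Finset (ℤ × ℤ × Bool), ∀ g, g ∈ K ↔ g ∈ 𝒢.inner :=
    ⟨(𝒢.finite_inner hV).toFinset, by simp⟩
  have hdisj : Disjoint (K ∪ C.image 𝒢.edge) (R.image 𝒢.edge) := by
    refine Finset.disjoint_right.2 fun g hg hg' => ?_
    obtain ⟨r, hr, rfl⟩ := Finset.mem_image.1 hg
    rcases Finset.mem_union.1 hg' with h | h
    · exact 𝒢.edge_notMem_inner subset_rfl ((hEmem r).1 (hRE hr)) ((hK _).1 h)
    · obtain ⟨c, hc, h⟩ := Finset.mem_image.1 h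
      rw [hinj (hC hc) (hRE hr) h] at hc
      exact (Finset.mem_sdiff.1 hr).2 (Finset.mem_union_left _ hc)
  have hcardA : ∀ (p : ℤ × ℤ × Bool → Prop) [DecidablePred p],
      (((R.image 𝒢.edge).filter p).Nonempty ∧ ((R.image 𝒢.edge).filter p).card ≤ 3) →
      (R.filter fun e => p (𝒢.edge e)).Nonempty ∧
      (R.filter fun e => p (𝒢.edge e)).card ≤ 3 := by
    intro p _ hp
    rw [Finset.filter_image, Finset.image_nonempty, Finset.card_image_of_injOn] at hp
    · exact hp
    · exact hinj.mono fun e he => hRE (Finset.mem_filter.1 he).1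
  rcases exists_small_cut_or_flow gridTail gridHead gridRight gridLeft
    exists_eq_coboundary_of_grid_flow sum_coboundary_mul_coboundary_grid hdisj
    (hR.image 𝒢.edge) with ⟨ψ, hψ, hA⟩ | ⟨u, hu0, hu, hA⟩
  · obtain ⟨hA0, hA3⟩ := hcardA (coboundary gridTail gridHead ψ · ≠ 0) hA
    refine ⟨_, Finset.filter_subset _ _, hA0, hA3, .inl fun S hS hCS hSD hSA => ?_⟩
    obtain ⟨φ, hφ⟩ := 𝒢.exists_potential fun g hg =>
      hψ g (Finset.mem_union_left _ ((hK g).2 hg))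
    obtain ⟨T, hT, hTS⟩ := h𝒯 S hS
    have hconst : ∀ x ∈ G.vertexSet, ∀ y ∈ G.vertexSet, φ x = φ y := by
      intro x hx y hy
      rw [← hT.1.vertexSet_eq] at hx hy
      refine hT.2.1.eq_of_forall_isLink (fun e x y he => ?_) hx hy
      have heE := Graph.edgeSet_subset_nonloops hT he.edge_mem
      have heS := (hTS e).1 he.edge_mem
      have h0 : φ (𝒢.head e) - φ (𝒢.tail e) = 0 := by
        rw [← hφ e heE]
        by_cases heC : e ∈ C
        · exact hψ _ (Finset.mem_union_right _ (Finset.mem_image_of_mem _ heC))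
        · by_contra hne
          refine Finset.disjoint_left.1 hSA heS (Finset.mem_filter.2 ⟨?_, hne⟩)
          rw [hRdef, Finset.mem_sdiff, Finset.mem_union, not_or]
          exact ⟨(hEmem e).2 heE, heC, Finset.disjoint_left.1 hSD heS⟩
      rcases (he.mono hT.1.le).eq_and_eq_or_eq_and_eq (𝒢.isLink e heE) with
        ⟨rfl, rfl⟩ | ⟨rfl, rfl⟩ <;> linarith
    obtain ⟨a, ha⟩ := hA0
    obtain ⟨haR, ha⟩ := Finset.mem_filter.1 ha
    have haE := (hEmem a).1 (hRE haR)
    have hl := 𝒢.isLink a haE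
    rw [hφ a haE, hconst _ hl.left_mem _ hl.right_mem, sub_self] at ha
    exact ha rfl
  · obtain ⟨hA0, hA3⟩ := hcardA (u · ≠ 0) hA
    refine ⟨_, Finset.filter_subset _ _, hA0, hA3, .inr fun S hS hCS hSD hAS => ?_⟩
    obtain ⟨T, hT, hTS⟩ := h𝒯 S hS
    set A := R.filter fun e => u (𝒢.edge e) ≠ 0 with hAdef
    have hAR : A ⊆ R := Finset.filter_subset _ _
    have hACE : A ∪ C ⊆ E := Finset.union_subset (hAR.trans hRE) hC
    have hflow : ∀ φ : α → ℚ,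
        ∑ e ∈ A ∪ C, u (𝒢.edge e) * (φ (𝒢.head e) - φ (𝒢.tail e)) = 0 := by
      intro φ
      obtain ⟨ψ, hψ, hφ⟩ := 𝒢.exists_grid_potential φ
      -- The grid flow may be nonzero on inner edges, but `ψ` is constant on branch sets, so these
      -- terms vanish.
      rw [← hu ψ, ← Finset.sum_subset (s₁ := (A ∪ C).image 𝒢.edge),
        Finset.sum_image (hinj.mono hACE)]
      · exact Finset.sum_congr rfl fun e he => by rw [hφ e ((hEmem e).1 (hACE he))]
      · rw [Finset.image_union]
        exact Finset.union_subset_union (Finset.image_subset_image hAR)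
          Finset.subset_union_right
      · intro g hg hg'
        rw [Finset.image_union, Finset.mem_union, not_or] at hg'
        rw [Finset.mem_union, Finset.mem_union] at hg
        rcases hg with hg | hg | hg
        · obtain ⟨r, hr, rfl⟩ := Finset.mem_image.1 hg
          by_contra hne
          exact hg'.1 (Finset.mem_image_of_mem _
            (Finset.mem_filter.2 ⟨hr, left_ne_zero_of_mul hne⟩))
        · rw [hψ g ((hK g).1 hg), mul_zero]
        · exact absurd hg hg'.2
    obtain ⟨a, ha⟩ := hA0
    refine (Finset.mem_filter.1 ha).2 (hT.2.2.eq_zero_of_flow (S := A ∪ C) (src := 𝒢.tail)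
      (tgt := 𝒢.head) (z := fun e => u (𝒢.edge e)) (fun e he => ?_) hflow
      (Finset.mem_union_left _ ha))
    refine (hT.1.le.isLink_iff ?_).2 (𝒢.isLink e ((hEmem e).1 (hACE he)))
    exact (hTS e).2 (Finset.union_subset hAS hCS he)

end Graph.GridMinor

end SpanningTrees

theorem theorem1 :
    ∃ τ : ℝ, IsGreatest {x : ℝ | x ^ 3 - x ^ 2 - 3 = 0} τ ∧
      1.8637065 ≤ τ ∧ τ < 1.8637066 ∧
      ∀ (α : Type*) (β : Type*) (G : Graph α β),
        G.vertexSet.Finite → G.edgeSet.Finite → G.IsPlanar →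
          (G.spanningTrees.ncard : ℝ) ≤ τ ^ G.edgeSet.ncard := by
  obtain ⟨τ, hτ, hlo, hhi⟩ := exists_isGreatest_cubic_root
  refine ⟨τ, hτ, hlo, hhi, fun α β G hV hE ⟨𝒟⟩ => ?_⟩
  have h1 : 1 ≤ τ := by linarith
  -- From τ ≤ 2 follows τ + 1 ≤ 3 = τ^3 - τ^2.
  have h3 : τ ^ 2 + τ + 1 ≤ τ ^ 3 := by
    have : τ ^ 3 - τ ^ 2 - 3 = 0 := hτ.1
    linarith
  -- A spanning tree supplies a vertex, which the construction of the grid minor needs.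
  rcases G.spanningTrees.eq_empty_or_nonempty with h0 | ⟨T, hT⟩
  · rw [h0, Set.ncard_empty, Nat.cast_zero]
    positivity
  · obtain ⟨x, -⟩ := hT.2.1.1
    have : Nonempty α := ⟨x⟩
    obtain ⟨𝒢⟩ := 𝒟.nonempty_gridMinor hV hE
    have hsub : G.nonloops ⊆ G.edgeSet := fun e he => he.1
    exact (𝒢.ncard_spanningTrees_le hV (hE.subset hsub) h1 h3).trans
      (pow_le_pow_right₀ h1 (Set.ncard_le_ncard hsub hE))
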